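/- Let $0<\varphi<\theta<1$ be constants and let $B_1,B_2,\dots$ be i.i.d. $\{0,1\}$-valued random variables with $\mathbb{P}(B_i=1)=\theta$. For $n\ge 1$ put $S_n=\sum_{i=1}^n B_i$ and $\hat\Theta=\hat\Theta_n=S_n/n$. Consider the following three $p$-values for the null hypothesis that the success probability is at most $\varphi$ (with the convention $x^0=1$ for every base, also a formally undefined one such as $\frac{1-\varphi}{0}$): $$P_{\mathrm{X},n}=\sum_{k=S_n}^{n}\binom nk\varphi^k(1-\varphi)^{n-k},$$ $$P_{\mathrm{CH},n}=\begin{cases}\left(\frac{\varphi}{\hat\Theta}\right)^{n\hat\Theta}\left(\frac{1-\varphi}{1-\hat\Theta}\right)^{n(1-\hat\Theta)}&\text{if }\hat\Theta\ge\varphi,\\ 1&\text{otherwise,}\end{cases}$$ $$P_{\mathrm{PBR},n}=\max_{0\le\varphi'\le\varphi}\ (\varphi')^{n\hat\Theta}(1-\varphi')^{n(1-\hat\Theta)}(n+1)\binom{n}{n\hat\Theta}.$$ For $P$ any one of these, let $G_n(P)=-\log(P_n)/n$ be the gain per trial (natural logarithm), and let $$\mathrm{KL}(\theta|\varphi)=\theta\log\frac{\theta}{\varphi}+(1-\theta)\log\frac{1-\theta}{1-\varphi}$$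 be the Kullback--Leibler divergence of the Bernoulli distribution with parameter $\theta$ from the one with parameter $\varphi$. Then for each of $P=P_{\mathrm{CH}}$, $P=P_{\mathrm{PBR}}$ and $P=P_{\mathrm{X}}$, as $n\to\infty$, $$\sqrt n\,\bigl(G_n(P)-\mathrm{KL}(\theta|\varphi)\bigr)\xrightarrow{D}N(0,\sigma_G^2),\qquad \sigma_G^2=\theta(1-\theta)\left(\log\left(\frac{\theta}{1-\theta}\,\frac{1-\varphi}{\varphi}\right)\right)^2,$$ where $N(0,\sigma_G^2)$ is the normal distribution with mean $0$ and variance $\sigma_G^2$. -/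

import Mathlib

noncomputable section

namespace BernoulliTests

open MeasureTheory ProbabilityTheory InformationTheory

/-- The Bernoulli distribution on `{0, 1}` with success probability `θ`. -/
def nu (θ : unitInterval) : Measure (Fin 2) := bernoulliMeasure 1 0 θ

/-- The Kullback-Leibler divergence (natural logarithm) of the Bernoulli distribution with
parameter `t` from the one with parameter `φ`. -/
def KL (t φ : unitInterval) : ℝ := (klDiv (nu t) (nu φ)).toReal

/-- The divergence is the usual finite expression; `toReal` loses nothing here. -/
theorem KL_eq (t φ : unitInterval) (h0 : 0 < φ) (h1 : φ < 1) :
    KL t φ = t * Real.log (t / φ) + (1 - t) * Real.log ((1 - t) / (1 - φ)) := by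
  have h0' : (0:ℝ) < φ := h0
  have h1' : (0:ℝ) < 1 - φ := sub_pos.2 (show (φ:ℝ) < 1 from h1)
  have ht0 : (0:ℝ) ≤ t := t.2.1
  have ht1 : (0:ℝ) ≤ 1 - t := sub_nonneg.2 t.2.2
  let f : Fin 2 → ℝ := fun i => if i = 1 then t / φ else (1 - t) / (1 - φ)
  have hf : ∀ i, 0 ≤ f i := by intro i; simp only [f]; split_ifs <;> positivity
  have e : nu t = (nu φ).withDensity (fun i => ENNReal.ofReal (f i)) := by
    refine Measure.ext_of_singleton fun i => ?_
    rw [withDensity_apply _ (measurableSet_singleton _), lintegral_singleton]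
    unfold nu
    fin_cases i
    · rw [bernoulliMeasure_apply_of_notMem_of_mem _ (by measurability) (by simp) (by simp),
        bernoulliMeasure_apply_of_notMem_of_mem _ (by measurability) (by simp) (by simp)]
      have : ((unitInterval.toNNReal (unitInterval.symm φ) : NNReal) : ENNReal) = ENNReal.ofReal (1 - φ) := by
        rw [← ENNReal.ofReal_coe_nnreal]; simp
      rw [this, ← ENNReal.ofReal_mul (hf _), ← ENNReal.ofReal_coe_nnreal]
      congr 1
      simp [f]; field_simp
    · rw [bernoulliMeasure_apply_of_mem_of_notMem _ (by measurability) (by simp) (by simp),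
        bernoulliMeasure_apply_of_mem_of_notMem _ (by measurability) (by simp) (by simp)]
      have : ((unitInterval.toNNReal φ : NNReal) : ENNReal) = ENNReal.ofReal φ := by
        rw [← ENNReal.ofReal_coe_nnreal]; simp
      rw [this, ← ENNReal.ofReal_mul (hf _), ← ENNReal.ofReal_coe_nnreal]
      congr 1
      simp [f]; field_simp
  have hp : ∀ s, IsProbabilityMeasure (nu s) := fun s => by unfold nu; infer_instance
  have hac : nu t ≪ nu φ := by rw [e]; exact withDensity_absolutelyContinuous _ _
  have hr : (nu t).rnDeriv (nu φ) =ᵐ[nu φ] fun i => ENNReal.ofReal (f i) := by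
    conv_lhs => rw [e]
    exact Measure.rnDeriv_withDensity _ (measurable_of_finite _)
  unfold KL
  rw [toReal_klDiv_of_measure_eq hac (by simp)]
  have : ∫ a, llr (nu t) (nu φ) a ∂(nu t) = ∫ a, Real.log (f a) ∂(nu t) := by
    apply integral_congr_ae
    filter_upwards [hac.ae_le hr] with i hi
    simp [llr, hi, hf]
  rw [this]; unfold nu
  rw [integral_bernoulliMeasure]; simp [f]

/-- The number of successes among the first `n` trials. -/
def successes {Ω : Type*} (B : ℕ → Ω → Fin 2) (n : ℕ) (ω : Ω) : ℕ :=
  ∑ i ∈ Finset.range n, (B i ω : ℕ)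

/-- The empirical success probability for `s` successes in `n` trials. -/
def freq (n s : ℕ) : ℝ := s / n

/-- The p-value of the exact test, for `s` successes in `n` trials. -/
def PX (n s : ℕ) (φ : ℝ) : ℝ :=
  ∑ k ∈ Finset.Icc s n, (n.choose k : ℝ) * φ ^ k * (1 - φ) ^ (n - k)

/-- The p-value of the Chernoff-Hoeffding test, for `s` successes in `n` trials. The convention
`x ^ 0 = 1` gives the value `φ ^ n` when all the trials are successes. -/
def PCH (n s : ℕ) (φ : ℝ) : ℝ :=
  if φ ≤ freq n s then
    (φ / freq n s) ^ s * ((1 - φ) / (1 - freq n s)) ^ (n - s)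
  else 1

/-- The p-value of the probability-based-ratio test of the point null with parameter `φ`,
for `s` successes in `n` trials. -/
def PPBR0 (n s : ℕ) (φ : ℝ) : ℝ :=
  φ ^ s * (1 - φ) ^ (n - s) * (n + 1) * (n.choose s : ℝ)

/-- The p-value of the probability-based-ratio test of the one-sided null with parameter `φ`:
the maximum of the p-values of the point nulls with parameter at most `φ`. -/
def PPBR (n s : ℕ) (φ : ℝ) : ℝ := sSup (PPBR0 n s '' Set.Icc 0 φ)

/-- The supremum in the definition of `PPBR` is a maximum. -/
theorem isGreatest_PPBR (n s : ℕ) {φ : ℝ} (hφ : 0 ≤ φ) :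
    IsGreatest (PPBR0 n s '' Set.Icc 0 φ) (PPBR n s φ) := by
  have hc : Continuous (PPBR0 n s) := by unfold PPBR0; fun_prop
  exact (isCompact_Icc.image hc).isGreatest_sSup ((Set.nonempty_Icc.2 hφ).image _)

/-- The gain per trial of a p-value `p` obtained from `n` trials. -/
def gain (n : ℕ) (p : ℝ) : ℝ := -Real.log p / n

/-- The asymptotic variance. -/
def sigmaSq (θ φ : ℝ) : ℝ := θ * (1 - θ) * Real.log (θ / (1 - θ) * ((1 - φ) / φ)) ^ 2

end BernoulliTests

end

/-!
Write `t = S / n` for the empirical frequency. The Chernoff-Hoeffding p-value is the ratio of the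
likelihood at `φ` to the maximal likelihood, the one at `t`, so that its gain per trial is exactly
the divergence `bernoulliKL φ t` as soon as `φ ≤ t < 1`.

The two other p-values differ from it by a factor of at most `n + 1`. The reason is that the
binomial distribution with parameter `t = S / n` has its mode at `S`
(`binomial_le_binomial_mode`), so that the mass of that mode lies between `1 / (n + 1)` and `1`.
For the exact test this bounds the first term of the tail sum from below, and the Chernoff bound
`PX_le_PCH` gives the other direction. For the probability-based-ratio test the likelihood is
monotone up to `t`, so the maximum over the null is attained at `φ`. Hence all three gains
equal `bernoulliKL φ t` up to `log (n + 1) / n` (`abs_gain_sub_bernoulliKL_le`), an error which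
vanishes even after multiplication by `√n`. By the law of large numbers `φ < t < 1`
holds almost surely for all large `n`, so what happens for other counts does not matter.

It remains to apply the delta method to `bernoulliKL φ`, whose derivative at `θ` is
`log (θ / (1 - θ) * ((1 - φ) / φ))`: its increment is the product of `t - θ` and the difference
quotient `dslope (bernoulliKL φ) θ t`. After scaling by `√n`, the first factor converges in
distribution by the central limit theorem and the second almost surely by the law of large numbers,
so Slutsky's theorem applies to the product.
-/

namespace BernoulliTests

open MeasureTheory ProbabilityTheory Filter Topology

/-! ### The mode of the binomial distribution -/

/-- The Poisson weight `s ^ k / k!` is largest at `k = s`. -/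
theorem factorial_mul_pow_le_factorial_mul_pow (s k : ℕ) :
    s.factorial * s ^ k ≤ k.factorial * s ^ s := by
  rcases le_total s k with h | h
  · calc s.factorial * s ^ k = s.factorial * s ^ (k - s) * s ^ s := by
          rw [mul_assoc, ← pow_add, Nat.sub_add_cancel h]
      _ ≤ k.factorial * s ^ s :=
          Nat.mul_le_mul_right _ (Nat.factorial_mul_pow_sub_le_factorial h)
  · have h1 : s.factorial ≤ s ^ (s - k) * k.factorial := by
      obtain ⟨d, rfl⟩ := Nat.exists_eq_add_of_le h
      have h2 := Nat.factorial_mul_descFactorial (n := k + d) (k := d) (by omega)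
      have h3 := Nat.descFactorial_le_pow (k + d) d
      simp only [Nat.add_sub_cancel, Nat.add_sub_cancel_left] at h2 ⊢
      rw [← h2, mul_comm]
      exact Nat.mul_le_mul_right _ h3
    calc s.factorial * s ^ k ≤ s ^ (s - k) * k.factorial * s ^ k := Nat.mul_le_mul_right _ h1
      _ = k.factorial * s ^ s := by
          rw [mul_comm (s ^ _), mul_assoc, ← pow_add, Nat.sub_add_cancel h]

/-- The binomial distribution with `n` trials and success probability `s / n` has its mode at
`s`. -/
theorem binomial_le_binomial_mode {n s k : ℕ} (hs : s ≤ n) (hk : k ≤ n) :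
    (n.choose k : ℝ) * freq n s ^ k * (1 - freq n s) ^ (n - k)
      ≤ n.choose s * freq n s ^ s * (1 - freq n s) ^ (n - s) := by
  rcases n.eq_zero_or_pos with rfl | hn
  · obtain rfl : s = 0 := by omega
    obtain rfl : k = 0 := by omega
    rfl
  have hn' : (0 : ℝ) < n := by exact_mod_cast hn
  have h1 : 1 - freq n s = ((n - s : ℕ) : ℝ) / n := by
    rw [freq, Nat.cast_sub hs]; field_simp
  -- A binomial term is `n!` times a product of two Poisson weights, each maximal at its own mean.
  have key : n.choose k * s ^ k * (n - s) ^ (n - k) ≤ n.choose s * s ^ s * (n - s) ^ (n - s) := by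
    have e1 := Nat.choose_mul_factorial_mul_factorial hk
    have e2 := Nat.choose_mul_factorial_mul_factorial hs
    have f1 := factorial_mul_pow_le_factorial_mul_pow s k
    have f2 := factorial_mul_pow_le_factorial_mul_pow (n - s) (n - k)
    have f3 := Nat.mul_le_mul f1 f2
    have hpos : 0 < s.factorial * (n - s).factorial := by positivity
    refine Nat.le_of_mul_le_mul_left ?_ hpos
    calc s.factorial * (n - s).factorial * (n.choose k * s ^ k * (n - s) ^ (n - k))
        = n.choose k * (s.factorial * s ^ k * ((n - s).factorial * (n - s) ^ (n - k))) := by ring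
      _ ≤ n.choose k * (k.factorial * s ^ s * ((n - k).factorial * (n - s) ^ (n - s))) :=
          Nat.mul_le_mul_left _ f3
      _ = (n.choose k * k.factorial * (n - k).factorial) * (s ^ s * (n - s) ^ (n - s)) := by ring
      _ = (n.choose s * s.factorial * (n - s).factorial) * (s ^ s * (n - s) ^ (n - s)) := by
          rw [e1, e2]
      _ = _ := by ring
  have key' : (n.choose k : ℝ) * s ^ k * ((n - s : ℕ) : ℝ) ^ (n - k)
      ≤ n.choose s * s ^ s * ((n - s : ℕ) : ℝ) ^ (n - s) := by exact_mod_cast key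
  have e (j : ℕ) (hj : j ≤ n) : (n.choose j : ℝ) * freq n s ^ j * (1 - freq n s) ^ (n - j)
      = n.choose j * s ^ j * ((n - s : ℕ) : ℝ) ^ (n - j) / (n : ℝ) ^ n := by
    rw [h1, freq, div_pow, div_pow, ← mul_div_assoc (n.choose j : ℝ), div_mul_div_comm, ← pow_add,
      Nat.add_sub_cancel' hj]
  rw [e k hk, e s hs]
  gcongr

theorem sum_binomial_eq_one (n : ℕ) (p : ℝ) :
    ∑ k ∈ Finset.range (n + 1), (n.choose k : ℝ) * p ^ k * (1 - p) ^ (n - k) = 1 := by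
  have h := add_pow p (1 - p) n
  rw [add_sub_cancel, one_pow] at h
  exact (Finset.sum_congr rfl fun k _ => by ring).trans h.symm

/-- The mode of the binomial distribution carries at least the average mass `1 / (n + 1)`. -/
theorem one_le_mul_binomial_mode {n s : ℕ} (hs : s ≤ n) :
    1 ≤ (n + 1 : ℝ) * (n.choose s * freq n s ^ s * (1 - freq n s) ^ (n - s)) := by
  refine (sum_binomial_eq_one n (freq n s)).symm.le.trans ?_
  refine (Finset.sum_le_card_nsmul _ _ _ fun k hk =>
    binomial_le_binomial_mode hs (Finset.mem_range_succ_iff.1 hk)).trans ?_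
  simp

/-- The likelihood `p ^ s * (1 - p) ^ (n - s)` is monotone in `p` up to its maximizer `s / n`. -/
theorem likelihood_le_likelihood {n s : ℕ} (hs : s ≤ n) {p φ : ℝ} (hp : 0 ≤ p) (hpφ : p ≤ φ)
    (h0 : 0 < φ) (h1 : φ < 1) (hφ : φ * n ≤ s) :
    p ^ s * (1 - p) ^ (n - s) ≤ φ ^ s * (1 - φ) ^ (n - s) := by
  have h1' : 0 < 1 - φ := by linarith
  have hx : 0 ≤ p / φ := by positivity
  have hy : 0 ≤ (1 - p) / (1 - φ) := div_nonneg (by linarith) h1'.le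
  have hxy : (p / φ) ^ s * ((1 - p) / (1 - φ)) ^ (n - s) ≤ 1 := by
    -- By `x ≤ exp (x - 1)` it suffices that the sum of the exponents is nonpositive; it is
    -- `-(φ - p) (s - φ n) / (φ (1 - φ))`.
    have a (x : ℝ) : x ≤ Real.exp (x - 1) := by linarith [Real.add_one_le_exp (x - 1)]
    calc (p / φ) ^ s * ((1 - p) / (1 - φ)) ^ (n - s)
        ≤ Real.exp (p / φ - 1) ^ s * Real.exp ((1 - p) / (1 - φ) - 1) ^ (n - s) := by
          gcongr <;> exact a _
      _ = Real.exp (s * (p / φ - 1) + (n - s) * ((1 - p) / (1 - φ) - 1)) := by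
          rw [← Real.exp_nat_mul, ← Real.exp_nat_mul, ← Real.exp_add, Nat.cast_sub hs]
      _ ≤ 1 := by
          rw [Real.exp_le_one_iff]
          have : s * (p / φ - 1) + (n - s) * ((1 - p) / (1 - φ) - 1)
              = -((φ - p) * (s - φ * n) / (φ * (1 - φ))) := by
            field_simp; ring
          rw [this, neg_nonpos]
          exact div_nonneg (mul_nonneg (by linarith) (by linarith)) (by positivity)
  rw [div_pow, div_pow, div_mul_div_comm, div_le_one (by positivity)] at hxy
  exact hxy

/-! ### Comparison of the p-values -/

section Comparison

variable {n s : ℕ} {φ : ℝ}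

theorem lt_of_freq_lt_one (hn : 0 < n) (h1 : freq n s < 1) : s < n := by
  rw [freq, div_lt_one (by exact_mod_cast hn)] at h1
  exact_mod_cast h1

theorem PCH_pos (h0 : 0 < φ) (hφ : φ ≤ freq n s) (h1 : freq n s < 1) : 0 < PCH n s φ := by
  have : 0 < 1 - freq n s := by linarith
  have : 0 < 1 - φ := by linarith
  have : 0 < freq n s := by linarith
  rw [PCH, if_pos hφ]
  positivity

/-- `PCH` is the ratio of the likelihood at `φ` to the maximal likelihood. -/
theorem PCH_mul_likelihood (h0 : 0 < φ) (hφ : φ ≤ freq n s) (h1 : freq n s < 1) :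
    PCH n s φ * (freq n s ^ s * (1 - freq n s) ^ (n - s)) = φ ^ s * (1 - φ) ^ (n - s) := by
  have h2 : 0 < 1 - freq n s := by linarith
  have h3 : 0 < freq n s := by linarith
  rw [PCH, if_pos hφ, div_pow, div_pow]
  field_simp

/-- The exact p-value is at least its first term, which is within a factor `n + 1` of `PCH`. -/
theorem PCH_le_mul_PX (hn : 0 < n) (h0 : 0 < φ) (hφ : φ ≤ freq n s) (h1 : freq n s < 1) :
    PCH n s φ ≤ (n + 1) * PX n s φ := by
  have hs := (lt_of_freq_lt_one hn h1).le
  have h1' : 0 ≤ 1 - φ := by linarith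
  calc PCH n s φ
      ≤ PCH n s φ * ((n + 1 : ℝ) * (n.choose s * freq n s ^ s * (1 - freq n s) ^ (n - s))) :=
        le_mul_of_one_le_right (PCH_pos h0 hφ h1).le (one_le_mul_binomial_mode hs)
    _ = (n + 1) * (n.choose s *
          (PCH n s φ * (freq n s ^ s * (1 - freq n s) ^ (n - s)))) := by ring
    _ = (n + 1) * (n.choose s * φ ^ s * (1 - φ) ^ (n - s)) := by
        rw [PCH_mul_likelihood h0 hφ h1, mul_assoc (n.choose s : ℝ)]
    _ ≤ (n + 1) * PX n s φ := by
        gcongr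
        exact Finset.single_le_sum
          (f := fun k => (n.choose k : ℝ) * φ ^ k * (1 - φ) ^ (n - k))
          (fun k _ => by positivity) (Finset.mem_Icc.2 ⟨le_rfl, hs⟩)

/-- The **Chernoff bound** for the exact p-value. The likelihood ratio of `φ` to `s / n` is largest
at `s` among all counts `k ≥ s`. -/
theorem PX_le_PCH (hn : 0 < n) (h0 : 0 < φ) (hφ : φ ≤ freq n s) (h1 : freq n s < 1) :
    PX n s φ ≤ PCH n s φ := by
  have hs := (lt_of_freq_lt_one hn h1).le
  have h2 : 0 < 1 - freq n s := by linarith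
  have h3 : 0 < freq n s := by linarith
  have h4 : 0 < 1 - φ := by linarith
  have hP := PCH_pos h0 hφ h1
  have hL := PCH_mul_likelihood h0 hφ h1
  set t := freq n s
  calc PX n s φ
      ≤ ∑ k ∈ Finset.Icc s n, PCH n s φ * ((n.choose k : ℝ) * t ^ k * (1 - t) ^ (n - k)) := by
        refine Finset.sum_le_sum fun k hk => ?_
        obtain ⟨hsk, hkn⟩ := Finset.mem_Icc.1 hk
        obtain ⟨d, rfl⟩ := Nat.exists_eq_add_of_le hsk
        have e : n - s = (n - (s + d)) + d := by omega
        -- Each success beyond `s` multiplies the likelihood ratio by `φ (1 - t) / (t (1 - φ)) ≤ 1`.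
        have hd : (φ * (1 - t)) ^ d ≤ (t * (1 - φ)) ^ d := by
          gcongr ?_ ^ d
          nlinarith
        have : φ ^ (s + d) * (1 - φ) ^ (n - (s + d))
            ≤ PCH n s φ * (t ^ (s + d) * (1 - t) ^ (n - (s + d))) := by
          refine le_of_mul_le_mul_right ?_ (show 0 < ((1 - t) * (1 - φ)) ^ d by positivity)
          calc φ ^ (s + d) * (1 - φ) ^ (n - (s + d)) * ((1 - t) * (1 - φ)) ^ d
              = φ ^ s * (1 - φ) ^ (n - s) * (φ * (1 - t)) ^ d := by
                rw [e, pow_add, pow_add, mul_pow, mul_pow]; ring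
            _ ≤ φ ^ s * (1 - φ) ^ (n - s) * (t * (1 - φ)) ^ d := by gcongr
            _ = PCH n s φ * (t ^ s * (1 - t) ^ (n - s)) * (t * (1 - φ)) ^ d := by rw [hL]
            _ = _ := by
                rw [e, pow_add, pow_add, mul_pow, mul_pow]; ring
        calc _ = (n.choose (s + d) : ℝ) * (φ ^ (s + d) * (1 - φ) ^ (n - (s + d))) := by ring
          _ ≤ (n.choose (s + d) : ℝ) * (PCH n s φ * (t ^ (s + d) * (1 - t) ^ (n - (s + d)))) := by
              gcongr
          _ = _ := by ring
    _ ≤ ∑ k ∈ Finset.range (n + 1),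
          PCH n s φ * ((n.choose k : ℝ) * t ^ k * (1 - t) ^ (n - k)) := by
        refine Finset.sum_le_sum_of_subset_of_nonneg (fun k hk => ?_) fun k _ _ => by positivity
        exact Finset.mem_range_succ_iff.2 (Finset.mem_Icc.1 hk).2
    _ = PCH n s φ := by rw [← Finset.mul_sum, sum_binomial_eq_one, mul_one]

/-- Beyond `φ` the supremum over the null is attained at `φ`. -/
theorem PPBR_eq_PPBR0 (hn : 0 < n) (h0 : 0 < φ) (hφ : φ ≤ freq n s) (h1 : freq n s < 1) :
    PPBR n s φ = PPBR0 n s φ := by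
  have hs := (lt_of_freq_lt_one hn h1).le
  refine (isGreatest_PPBR n s h0.le).unique ⟨⟨φ, ⟨h0.le, le_rfl⟩, rfl⟩, ?_⟩
  rintro _ ⟨p, ⟨hp0, hp⟩, rfl⟩
  unfold PPBR0
  gcongr ?_ * _ * _
  refine likelihood_le_likelihood hs hp0 hp h0 (by linarith) ?_
  rwa [freq, le_div_iff₀ (by exact_mod_cast hn)] at hφ

theorem PPBR_eq_PCH_mul (hn : 0 < n) (h0 : 0 < φ) (hφ : φ ≤ freq n s) (h1 : freq n s < 1) :
    PPBR n s φ = PCH n s φ *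
      ((n + 1) * (n.choose s * freq n s ^ s * (1 - freq n s) ^ (n - s))) := by
  rw [PPBR_eq_PPBR0 hn h0 hφ h1, PPBR0, ← PCH_mul_likelihood h0 hφ h1]
  ring

theorem PCH_le_PPBR (hn : 0 < n) (h0 : 0 < φ) (hφ : φ ≤ freq n s) (h1 : freq n s < 1) :
    PCH n s φ ≤ PPBR n s φ := by
  rw [PPBR_eq_PCH_mul hn h0 hφ h1]
  exact le_mul_of_one_le_right (PCH_pos h0 hφ h1).le
    (one_le_mul_binomial_mode (lt_of_freq_lt_one hn h1).le)

theorem PPBR_le_mul_PCH (hn : 0 < n) (h0 : 0 < φ) (hφ : φ ≤ freq n s) (h1 : freq n s < 1) :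
    PPBR n s φ ≤ (n + 1) * PCH n s φ := by
  have hs := (lt_of_freq_lt_one hn h1).le
  have h2 : 0 ≤ 1 - freq n s := by linarith
  have h3 : 0 ≤ freq n s := by linarith
  rw [PPBR_eq_PCH_mul hn h0 hφ h1, mul_comm]
  refine mul_le_mul_of_nonneg_right ?_ (PCH_pos h0 hφ h1).le
  refine mul_le_of_le_one_right (by positivity) ?_
  exact (Finset.single_le_sum
    (f := fun k => (n.choose k : ℝ) * freq n s ^ k * (1 - freq n s) ^ (n - k))
    (fun k _ => by positivity) (Finset.mem_range_succ_iff.2 hs)).trans_eq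
    (sum_binomial_eq_one n (freq n s))

end Comparison

/-! ### The empirical divergence -/

/-- The Kullback-Leibler divergence of the Bernoulli distributions with real parameters `t` and `φ`,
as a function of `t`, for `0 < t < 1`
and `0 < φ < 1`. -/
noncomputable def bernoulliKL (φ t : ℝ) : ℝ :=
  t * Real.log (t / φ) + (1 - t) * Real.log ((1 - t) / (1 - φ))

theorem hasDerivAt_bernoulliKL {φ t : ℝ} (hφ0 : 0 < φ) (hφ1 : φ < 1) (ht0 : 0 < t) (ht1 : t < 1) :
    HasDerivAt (bernoulliKL φ) (Real.log (t / (1 - t) * ((1 - φ) / φ))) t := by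
  have h1 : 0 < 1 - t := by linarith
  have h2 : 0 < 1 - φ := by linarith
  have d1 : HasDerivAt (fun x : ℝ => 1 - x) (-1) t := by
    simpa using (hasDerivAt_id t).const_sub 1
  have a := (hasDerivAt_id t).mul (((hasDerivAt_id t).div_const φ).log (div_pos ht0 hφ0).ne')
  have b := d1.mul ((d1.div_const (1 - φ)).log (by positivity))
  refine (a.add b).congr_deriv ?_
  rw [show t / (1 - t) * ((1 - φ) / φ) = (t / φ) / ((1 - t) / (1 - φ)) by field_simp,
    Real.log_div (div_pos ht0 hφ0).ne' (div_pos h1 h2).ne']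
  have e1 : t * (1 / φ / (t / φ)) = 1 := by field_simp
  have e2 : (1 - t) * (-1 / (1 - φ) / ((1 - t) / (1 - φ))) = -1 := by field_simp
  simp only [id]
  rw [e1, e2]
  ring

/-- The gain of the Chernoff-Hoeffding test is the divergence at the empirical frequency. -/
theorem gain_PCH {n s : ℕ} {φ : ℝ} (hn : 0 < n) (h0 : 0 < φ) (hφ : φ ≤ freq n s)
    (h1 : freq n s < 1) : gain n (PCH n s φ) = bernoulliKL φ (freq n s) := by
  have hs := (lt_of_freq_lt_one hn h1).le
  have h2 : 0 < 1 - freq n s := by linarith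
  have h3 : 0 < freq n s := by linarith
  have h4 : 0 < 1 - φ := by linarith
  have hn' : (n : ℝ) ≠ 0 := by exact_mod_cast hn.ne'
  have es : (s : ℝ) = n * freq n s := by rw [freq]; field_simp
  rw [gain, PCH, if_pos hφ, Real.log_mul (by positivity) (by positivity), Real.log_pow,
    Real.log_pow, Nat.cast_sub hs, bernoulliKL, Real.log_div h0.ne' h3.ne',
    Real.log_div h3.ne' h0.ne', Real.log_div h4.ne' h2.ne', Real.log_div h2.ne' h4.ne']
  generalize freq n s = t at *
  rw [es]
  field_simp
  ring

/-- Each of the three p-values is within a factor `n + 1` of `PCH`, so that its gain per trial is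
the empirical divergence up to `log (n + 1) / n`. -/
theorem abs_gain_sub_bernoulliKL_le {pval : ℕ → ℕ → ℝ → ℝ}
    (hpval : pval ∈ ({PCH, PPBR, PX} : Set (ℕ → ℕ → ℝ → ℝ))) {n s : ℕ} {φ : ℝ}
    (hn : 0 < n) (h0 : 0 < φ) (hφ : φ ≤ freq n s) (h1 : freq n s < 1) :
    |gain n (pval n s φ) - bernoulliKL φ (freq n s)| ≤ Real.log (n + 1) / n := by
  have hP := PCH_pos h0 hφ h1
  have hn' : (0 : ℝ) < n := by exact_mod_cast hn
  obtain ⟨hlo, hhi⟩ :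
      PCH n s φ ≤ (n + 1) * pval n s φ ∧ pval n s φ ≤ (n + 1) * PCH n s φ := by
    rcases hpval with rfl | rfl | rfl
    · constructor <;> nlinarith
    · have := PCH_le_PPBR hn h0 hφ h1
      exact ⟨by nlinarith, PPBR_le_mul_PCH hn h0 hφ h1⟩
    · have := PX_le_PCH hn h0 hφ h1
      exact ⟨PCH_le_mul_PX hn h0 hφ h1, by nlinarith⟩
  have hp : 0 < pval n s φ := by
    by_contra h
    nlinarith [mul_nonneg hn'.le (not_lt.1 h |> neg_nonneg.2)]
  have l1 := Real.log_le_log hP hlo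
  have l2 := Real.log_le_log hp hhi
  rw [Real.log_mul (by positivity) hp.ne'] at l1
  rw [Real.log_mul (by positivity) hP.ne'] at l2
  rw [← gain_PCH hn h0 hφ h1, gain, gain, ← sub_div, abs_div, abs_of_pos hn']
  gcongr
  rw [abs_le]
  constructor <;> linarith

theorem tendsto_log_succ_div_sqrt :
    Tendsto (fun n : ℕ => Real.log (n + 1) / √n) atTop (𝓝 0) := by
  have h1 : Tendsto (fun x : ℝ => Real.log x / x ^ (1 / 2 : ℝ)) atTop (𝓝 0) :=
    (isLittleO_log_rpow_atTop (by norm_num)).tendsto_div_nhds_zero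
  have h2 : Tendsto (fun n : ℕ => (Real.log 2 / √n) + Real.log n / √n) atTop (𝓝 (0 + 0)) := by
    refine .add ?_ ?_
    · exact tendsto_const_nhds.div_atTop (Real.tendsto_sqrt_atTop.comp tendsto_natCast_atTop_atTop)
    · refine (h1.comp tendsto_natCast_atTop_atTop).congr fun n => ?_
      simp [Real.sqrt_eq_rpow]
  rw [add_zero] at h2
  refine squeeze_zero' (.of_forall fun n => ?_) ?_ h2
  · exact div_nonneg (Real.log_nonneg (by linarith [Nat.cast_nonneg (α := ℝ) n])) (by positivity)
  · filter_upwards [eventually_ge_atTop 1] with n hn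
    have hn' : (1 : ℝ) ≤ n := by exact_mod_cast hn
    rw [← add_div, ← Real.log_mul (by norm_num) (by positivity)]
    gcongr
    linarith

/-! ### Limit theorems for the empirical frequency -/

theorem cast_successes {Ω : Type*} (B : ℕ → Ω → Fin 2) (n : ℕ) (ω : Ω) :
    (successes B n ω : ℝ) = ∑ i ∈ Finset.range n, ((B i ω : ℕ) : ℝ) := by
  simp [successes]

section Probability

variable {Ω : Type*} [MeasurableSpace Ω] {P : Measure Ω} {θ φ : unitInterval} {B : ℕ → Ω → Fin 2}

theorem integral_comp_nu {X : Ω → Fin 2} (hX : HasLaw X (nu θ) P) (f : Fin 2 → ℝ) :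
    ∫ ω, f (X ω) ∂P = θ * f 1 + (1 - θ) * f 0 := by
  have h := hX.integral_comp (f := f) (by fun_prop)
  simp only [Function.comp_def] at h
  rw [h, nu, integral_bernoulliMeasure]
  simp

theorem variance_of_hasLaw_nu [IsProbabilityMeasure P] {X : Ω → Fin 2} (hX : HasLaw X (nu θ) P) :
    Var[fun ω => ((X ω : ℕ) : ℝ); P] = θ * (1 - θ) := by
  have hf : Measurable fun i : Fin 2 => ((i : ℕ) : ℝ) := measurable_of_finite _
  rw [variance_eq_integral (X := fun ω => ((X ω : ℕ) : ℝ))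
      (hf.comp_aemeasurable hX.aemeasurable),
    integral_comp_nu hX fun i => ((i : ℕ) : ℝ)]
  refine (integral_comp_nu hX
    fun i => (((i : ℕ) : ℝ) - (θ * ((1 : Fin 2) : ℕ) + (1 - θ) * ((0 : Fin 2) : ℕ))) ^ 2).trans ?_
  simp
  ring

theorem memLp_of_hasLaw_nu [IsProbabilityMeasure P] {X : Ω → Fin 2} (hX : HasLaw X (nu θ) P) :
    MemLp (fun ω => ((X ω : ℕ) : ℝ)) 2 P := by
  have hf : Measurable fun i : Fin 2 => ((i : ℕ) : ℝ) := measurable_of_finite _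
  refine MemLp.of_bound (hf.comp_aemeasurable hX.aemeasurable).aestronglyMeasurable 1
    (.of_forall fun ω => ?_)
  have : (X ω : ℕ) ≤ 1 := by omega
  simpa using (by exact_mod_cast this : ((X ω : ℕ) : ℝ) ≤ 1)

theorem identDistrib_of_hasLaw_nu (hlaw : ∀ i, HasLaw (B i) (nu θ) P) (i : ℕ) :
    IdentDistrib (fun ω => ((B i ω : ℕ) : ℝ)) (fun ω => ((B 0 ω : ℕ) : ℝ)) P P :=
  IdentDistrib.comp (u := fun i : Fin 2 => ((i : ℕ) : ℝ))
    ⟨(hlaw i).aemeasurable, (hlaw 0).aemeasurable, by rw [(hlaw i).map_eq, (hlaw 0).map_eq]⟩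
    (measurable_of_finite _)

theorem aemeasurable_successes (hB : ∀ i, AEMeasurable (B i) P) (n : ℕ) :
    AEMeasurable (successes B n) P := by
  have : ∀ i ∈ Finset.range n, AEMeasurable (fun ω => (B i ω : ℕ)) P := fun i _ =>
    (measurable_of_finite (fun j : Fin 2 => (j : ℕ))).comp_aemeasurable (hB i)
  exact Finset.aemeasurable_fun_sum _ this

/-- The law of large numbers for the empirical success probability. -/
theorem tendsto_freq_successes [IsProbabilityMeasure P] (hindep : iIndepFun B P)
    (hlaw : ∀ i, HasLaw (B i) (nu θ) P) :
    ∀ᵐ ω ∂P, Tendsto (fun n => freq n (successes B n ω)) atTop (𝓝 (θ : ℝ)) := by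
  have hf : Measurable fun i : Fin 2 => ((i : ℕ) : ℝ) := measurable_of_finite _
  have h := strong_law_ae_real (μ := P) (fun i ω => ((B i ω : ℕ) : ℝ))
    ((memLp_of_hasLaw_nu (hlaw 0)).integrable (by norm_num))
    (fun i j hij => (hindep.indepFun hij).comp hf hf) (identDistrib_of_hasLaw_nu hlaw)
  rw [integral_comp_nu (hlaw 0) fun i => ((i : ℕ) : ℝ)] at h
  filter_upwards [h] with ω hω
  simpa [freq, cast_successes] using hω

/-- The central limit theorem for the empirical success probability. -/
theorem tendstoInDistribution_freq_successes [IsProbabilityMeasure P] {Ω' : Type*}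
    [MeasurableSpace Ω'] {Q : Measure Ω'} [IsProbabilityMeasure Q] {Z : Ω' → ℝ}
    (hZ : HasLaw Z (gaussianReal 0 (θ * (1 - θ) : ℝ).toNNReal) Q) (hindep : iIndepFun B P)
    (hlaw : ∀ i, HasLaw (B i) (nu θ) P) :
    TendstoInDistribution (fun (n : ℕ) ω => √(n : ℝ) * (freq n (successes B n ω) - θ)) atTop Z
      (fun _ => P) Q := by
  have hf : Measurable fun i : Fin 2 => ((i : ℕ) : ℝ) := measurable_of_finite _
  have h := tendstoInDistribution_inv_sqrt_mul_sum_sub (P := P) (P' := Q) (Y := Z)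
    (X := fun i ω => ((B i ω : ℕ) : ℝ)) (by rwa [variance_of_hasLaw_nu (hlaw 0)])
    (memLp_of_hasLaw_nu (hlaw 0)) (hindep.comp (fun _ i => ((i : ℕ) : ℝ)) fun _ => hf)
    (identDistrib_of_hasLaw_nu hlaw)
  rw [integral_comp_nu (hlaw 0) fun i => ((i : ℕ) : ℝ)] at h
  refine h.congr (fun n => .of_forall fun ω => ?_) .rfl
  rcases n.eq_zero_or_pos with rfl | hn
  · simp
  have hn' : (0 : ℝ) < n := by exact_mod_cast hn
  have hs : √(n : ℝ) ≠ 0 := by positivity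
  have hq : √(n : ℝ) ^ 2 = n := Real.sq_sqrt hn'.le
  simp only [← cast_successes, freq]
  simp
  rw [inv_mul_eq_div, div_eq_iff hs]
  field_simp
  rw [hq]
  ring

end Probability

end BernoulliTests

open BernoulliTests MeasureTheory ProbabilityTheory Filter Topology in
theorem mainTheorem3 {Ω : Type*} [MeasurableSpace Ω] (P : MeasureTheory.Measure Ω)
    [MeasureTheory.IsProbabilityMeasure P] (θ φ : unitInterval)
    (hφ : 0 < φ) (hφθ : φ < θ) (hθ : θ < 1) (B : ℕ → Ω → Fin 2)
    (hindep : ProbabilityTheory.iIndepFun B P)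
    (hlaw : ∀ i, ProbabilityTheory.HasLaw (B i) (BernoulliTests.nu θ) P) :
    ∀ pval ∈ ({BernoulliTests.PCH, BernoulliTests.PPBR, BernoulliTests.PX} :
        Set (ℕ → ℕ → ℝ → ℝ)),
      MeasureTheory.TendstoInDistribution
        (fun (n : ℕ) (ω : Ω) => √(n : ℝ) *
          (BernoulliTests.gain n (pval n (BernoulliTests.successes B n ω) φ)
            - BernoulliTests.KL θ φ))
        Filter.atTop (id : ℝ → ℝ) (fun _ => P)
        (ProbabilityTheory.gaussianReal 0 (BernoulliTests.sigmaSq θ φ).toNNReal) := by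
  intro pval hpval
  have hφ0 : (0 : ℝ) < φ := hφ
  have hlt : (φ : ℝ) < θ := hφθ
  have hθ1 : (θ : ℝ) < 1 := hθ
  have hKL : KL θ φ = bernoulliKL φ θ := KL_eq θ φ hφ (hφθ.trans hθ)
  have hderiv := hasDerivAt_bernoulliKL hφ0 (hlt.trans hθ1) (hφ0.trans hlt) hθ1
  have hσ : sigmaSq θ φ
      = θ * (1 - θ) * Real.log (θ / (1 - θ) * ((1 - φ) / φ)) ^ 2 := rfl
  set c : ℝ := Real.log (θ / (1 - θ) * ((1 - φ) / φ))
  have hc0 : 0 < c := by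
    refine Real.log_pos ?_
    rw [div_mul_div_comm, one_lt_div (mul_pos (by linarith) hφ0)]
    nlinarith
  have hmeas (f : ℕ → ℝ) (n : ℕ) : AEMeasurable (fun ω => f (successes B n ω)) P :=
    (measurable_of_countable f).comp_aemeasurable
      (aemeasurable_successes (fun i => (hlaw i).aemeasurable) n)
  have hlln := tendsto_freq_successes hindep hlaw
  -- The limit of the normalized frequency is represented as `x ↦ x / c` under the law of the
  -- limiting gain, so that multiplying it by `c` gives the identity.
  have hZ : HasLaw (fun x : ℝ => x / c) (gaussianReal 0 (θ * (1 - θ) : ℝ).toNNReal)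
      (gaussianReal 0 (sigmaSq θ φ).toNNReal) := by
    have h := gaussianReal_div_const (HasLaw.id (μ := gaussianReal 0 (sigmaSq θ φ).toNNReal)) c
    have hv : (θ * (1 - θ) : ℝ).toNNReal
        = (sigmaSq θ φ).toNNReal / NNReal.mk (c ^ 2) (sq_nonneg c) := by
      have h0 : (0 : ℝ) ≤ θ * (1 - θ) := mul_nonneg θ.2.1 (by linarith)
      ext
      rw [NNReal.coe_div, Real.coe_toNNReal _ h0, hσ,
        Real.coe_toNNReal _ (mul_nonneg h0 (sq_nonneg c))]
      exact (mul_div_cancel_right₀ _ (by positivity)).symm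
    rw [zero_div] at h
    rw [hv]
    exact h
  have hclt := tendstoInDistribution_freq_successes hZ hindep hlaw
  -- The limit of the difference quotient of the divergence at `θ`, along the empirical frequencies.
  have hslope : ∀ᵐ ω ∂P, Tendsto
      (fun n => dslope (bernoulliKL φ) θ (freq n (successes B n ω))) atTop (𝓝 c) := by
    filter_upwards [hlln] with ω hω
    have h := (continuousAt_dslope_same.2 hderiv.differentiableAt).tendsto.comp hω
    rwa [dslope_same, hderiv.deriv] at h
  have hrem : ∀ᵐ ω ∂P, Tendsto (fun n : ℕ => √(n : ℝ) * (gain n (pval n (successes B n ω) φ)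
      - bernoulliKL φ (freq n (successes B n ω)))) atTop (𝓝 0) := by
    filter_upwards [hlln] with ω hω
    refine squeeze_zero_norm' ?_ tendsto_log_succ_div_sqrt
    filter_upwards [hω.eventually_const_lt hlt, hω.eventually_lt_const hθ1,
      eventually_gt_atTop 0] with n h1 h2 hn
    have h := abs_gain_sub_bernoulliKL_le hpval hn hφ0 h1.le h2
    have hn' : (0 : ℝ) < n := by exact_mod_cast hn
    rw [Real.norm_eq_abs, abs_mul, abs_of_nonneg (Real.sqrt_nonneg _)]
    refine (mul_le_mul_of_nonneg_left h (Real.sqrt_nonneg _)).trans_eq ?_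
    rw [mul_div_assoc', mul_comm, mul_div_assoc, Real.sqrt_div_self, div_eq_mul_inv]
  have hmul := hclt.continuous_comp_prodMk_of_tendstoInMeasure_const
    (g := fun x : ℝ × ℝ => x.1 * x.2) (by fun_prop)
    (tendstoInMeasure_of_tendsto_ae
      (fun n => (hmeas (fun s => dslope (bernoulliKL φ) θ (freq n s)) n).aestronglyMeasurable)
      hslope)
    (fun n => hmeas (fun s => dslope (bernoulliKL φ) θ (freq n s)) n)
  have hadd := hmul.add_of_tendstoInMeasure_const
    (tendstoInMeasure_of_tendsto_ae
      (fun n => (hmeas (fun s => √(n : ℝ) * (gain n (pval n s φ)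
        - bernoulliKL φ (freq n s))) n).aestronglyMeasurable) hrem)
    (fun n => hmeas (fun s => √(n : ℝ) * (gain n (pval n s φ) - bernoulliKL φ (freq n s))) n)
  refine hadd.congr (fun n => .of_forall fun ω => ?_) (.of_forall fun x => ?_)
  · have h := sub_smul_dslope (bernoulliKL φ) θ (freq n (successes B n ω))
    rw [smul_eq_mul] at h
    simp only [Pi.add_apply]
    rw [mul_assoc, h, hKL]
    ring
  · simp [hc0.ne']
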